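/- All extriangulated categories $(\mathcal{C},\mathbb{E},\mathfrak{s})$ are in the sense of Nakaoka–Palu; for $\eta\in\mathbb{E}(X,Y)$, $a:Y\to Y'$, $c:X'\to X$ write $a\cdot\eta=\mathbb{E}(X,a)(\eta)$ and $\eta\cdot c=\mathbb{E}(c,Y)(\eta)$. A sequence $B\to E\to A$ in the class $\mathfrak{s}(\eta)$ for some $\eta\in\mathbb{E}(A,B)$ is a conflation; its first (second) map is an inflation (deflation). **Definitions.** * $\mathcal{C}$ is *WIC* if, whenever $gf$ is an inflation, $f$ is an inflation, and whenever $gf$ is a deflation, $g$ is a deflation. * $\mathcal{C}$ is *AET3* (resp. *AET3\**) if coproducts (resp. products) indexed by any non-empty set exist in $\mathcal{C}$. * $\mathcal{C}$ is *AET4* if it is AET3 and, for every set $I\neq\emptyset$, there are homomorphisms $$\Gamma:\prod_{i\in I}\mathbb{E}(B_i,A)\to\mathbb{E}\Big(\coprod_{i\in I}B_i,A^{(I)}\Big),$$ natural in the family $(B_i)_{i\in I}$ and in $A$, such that (1) if $\eta_i$ is realized by $A\xrightarrow{f_i}E_i\xrightarrow{g_i}B_i$ for all $i$, then $\Gamma(\eta_i)_{i}$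 is realized by $A^{(I)}\xrightarrow{\coprod f_i}\coprod E_i\xrightarrow{\coprod g_i}\coprod B_i$; and (2) $\Gamma(\eta_i)_i\cdot\mu^B_i=\mu^A_i\cdot\eta_i$ for all $i\in I$, where $\mu_i^B:B_i\to\coprod_i B_i$ and $\mu_i^A:A\to A^{(I)}$ are the canonical inclusions. $\mathcal{C}$ is *AET4\** if $\mathcal{C}^{op}$ is AET4. * A *negative first extension* structure on $\mathcal{C}$ is an additive bifunctor $\mathbb{E}^{-1}:\mathcal{C}^{op}\times\mathcal{C}\to\mathrm{Ab}$ together with, for each $\delta\in\mathbb{E}(Z,X)$, natural transformations $\mathbb{E}^{-1}(-,Z)\to\mathcal{C}(-,X)$ and $\mathbb{E}^{-1}(X,-)\to\mathcal{C}(Z,-)$ such that, for every realization $X\to Y\to Z$ of $\delta$ and every $W\in\mathcal{C}$, the sequences $\mathbb{E}^{-1}(W,X)\to\mathbb{E}^{-1}(W,Y)\to\mathbb{E}^{-1}(W,Z)\to\mathcal{C}(W,X)\to\mathcal{C}(W,Y)$ and $\mathbb{E}^{-1}(Z,W)\to\mathbb{E}^{-1}(Y,W)\to\mathbb{E}^{-1}(X,W)\to\mathcal{C}(Z,W)\to\mathcal{C}(Y,W)$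 are exact. * $\mathcal{C}$ is *coproduct-compatible* (resp. *product-compatible*) if it is AET3 (resp. AET3\*), has a negative first extension, and for every $X\in\mathcal{C}$ and every family $(Y_i)_{i\in I}$ in $\mathcal{C}$ with $I\neq\emptyset$ the map $\mathbb{E}^{-1}(\coprod_i Y_i,X)\to\prod_i\mathbb{E}^{-1}(Y_i,X)$, induced by the inclusions $Y_i\to\coprod_iY_i$ (resp. $\mathbb{E}^{-1}(X,\prod_iY_i)\to\prod_i\mathbb{E}^{-1}(X,Y_i)$, induced by the projections) is surjective. * An additive functor $F$ between extriangulated categories is *extriangulated* if there are homomorphisms $\Gamma_F:\mathbb{E}(X,Y)\to\mathbb{F}(FX,FY)$, natural in $X$ and $Y$, with $F(\mathfrak{s}(\eta))=\mathfrak{t}(\Gamma_F(\eta))$. It is *right exact* if for every conflation $C_1\xrightarrow{a}C\xrightarrow{b}C_2$ there are conflations $B_1\to FC_1\xrightarrow{x}B_2$ and $B_2\xrightarrow{y}FC\xrightarrow{Fb}FC_2$ with $yx=Fa$; *left exact* is the dual notion. * A *recollement* $(\mathcal{A},\mathcal{B},\mathcal{C})$ of extriangulated categories consists of additive functors $i^*,i^!:\mathcal{B}\to\mathcal{A}$,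 $i_*:\mathcal{A}\to\mathcal{B}$, $j_!,j_*:\mathcal{C}\to\mathcal{B}$, $j^*:\mathcal{B}\to\mathcal{C}$ such that: $(i^*,i_*,i^!)$ and $(j_!,j^*,j_*)$ are adjoint triples; $i_*$, $j_!$, $j_*$ are fully faithful; $\operatorname{Im}(i_*)=\operatorname{Ker}(j^*)$ (essential image); $i^*$ and $j_!$ are right exact; $i^!$ and $j_*$ are left exact; $i_*$ and $j^*$ are extriangulated; $\operatorname{Hom}_{\mathcal{B}}(\operatorname{Im}i_*,\operatorname{Ker}i^!)=0=\operatorname{Hom}_{\mathcal{B}}(\operatorname{Ker}i^*,\operatorname{Im}i_*)$; and every object $B$ of $\mathcal{B}$ admits conflations $K\to B\to T$ and $T'\to B\to K'$ with $K\in\operatorname{Ker}i^*$, $T,T'\in\operatorname{Im}i_*$, $K'\in\operatorname{Ker}i^!$. **Theorem.** Let $(\mathcal{A},\mathcal{B},\mathcal{C})$ be a recollement of extriangulated categories such that $\mathcal{C}$ is coproduct-compatible (resp. product-compatible) and $\mathcal{B}$ is AET4 (resp. AET4\*) and WIC. Then $\mathcal{C}$ is AET4 (resp. AET4\*). -/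

import Mathlib

open CategoryTheory CategoryTheory.Limits Opposite

universe v u u₁ u₂ u₃

namespace Extri

/-! ## Bifunctors with values in abelian groups -/

section Bifunctor

variable {C : Type u} [Category.{v} C]

/-- The abelian group `F(X, Y)`, contravariant in `X` and covariant in `Y`. -/
abbrev Bi (F : Cᵒᵖ ⥤ C ⥤ AddCommGrpCat.{v}) (X Y : C) : Type v :=
  (F.obj (op X)).obj Y

/-- The covariant action `η ↦ a · η = F(X, a)(η)`. -/
def push (F : Cᵒᵖ ⥤ C ⥤ AddCommGrpCat.{v}) {X Y Y' : C} (a : Y ⟶ Y') :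
    Bi F X Y →+ Bi F X Y' :=
  ((F.obj (op X)).map a).hom

/-- The contravariant action `η ↦ η · c = F(c, Y)(η)`. -/
def pull (F : Cᵒᵖ ⥤ C ⥤ AddCommGrpCat.{v}) {X X' Y : C} (c : X' ⟶ X) :
    Bi F X Y →+ Bi F X' Y :=
  ((F.map c.op).app Y).hom

/-- The two actions commute. -/
theorem push_pull (F : Cᵒᵖ ⥤ C ⥤ AddCommGrpCat.{v}) {X X' Y Y' : C} (a : Y ⟶ Y') (c : X' ⟶ X)
    (δ : Bi F X Y) : push F a (pull F c δ) = pull F c (push F a δ) :=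
  (ConcreteCategory.congr_hom ((F.map c.op).naturality a) δ).symm

end Bifunctor

/-- A binary bicone in a preadditive category exhibits its point as the biproduct. -/
def IsBiprod {C : Type u} [Category.{v} C] [Preadditive C] {X Y : C}
    (b : BinaryBicone X Y) : Prop :=
  b.fst ≫ b.inl + b.snd ≫ b.inr = 𝟙 b.pt

/-- The bicone in `C` attached to a bicone in `Cᵒᵖ`. -/
def unopBicone {C : Type u} [Category.{v} C] [Preadditive C] {X Y : Cᵒᵖ}
    (b : BinaryBicone X Y) : BinaryBicone X.unop Y.unop where
  pt := b.pt.unop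
  fst := b.inl.unop
  snd := b.inr.unop
  inl := b.fst.unop
  inr := b.snd.unop
  inl_fst := by simp [← unop_comp]
  inl_snd := by simp [← unop_comp]
  inr_fst := by simp [← unop_comp]
  inr_snd := by simp [← unop_comp]

theorem unopBicone_isBiprod {C : Type u} [Category.{v} C] [Preadditive C] {X Y : Cᵒᵖ}
    {b : BinaryBicone X Y} (hb : IsBiprod b) : IsBiprod (unopBicone b) :=
  congrArg Quiver.Hom.unop hb

/-! ## Extriangulated categories -/

/-- An extriangulated structure (Nakaoka–Palu) on an additive category `C`.
The realization `𝔰` is encoded by the relation `Realizes x y δ`, which says that the sequence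
`X ⟶ Y ⟶ Z` belongs to the class `𝔰(δ)`, for `δ ∈ 𝔼(Z, X)`. -/
structure ExtriangulatedStructure (C : Type u) [Category.{v} C] [Preadditive C]
    [HasZeroObject C] [HasBinaryBiproducts C] where
  /-- (ET1) The biadditive functor `𝔼 : Cᵒᵖ × C ⥤ Ab`. -/
  E : Cᵒᵖ ⥤ C ⥤ AddCommGrpCat.{v}
  additive_left : E.Additive
  additive_right : ∀ X : Cᵒᵖ, (E.obj X).Additive
  /-- `X ⟶ Y ⟶ Z` is a member of the class `𝔰(δ)`. -/
  Realizes : ∀ {X Y Z : C}, (X ⟶ Y) → (Y ⟶ Z) → Bi E Z X → Prop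
  /-- `𝔰(δ)` is non-empty. -/
  exists_realizes : ∀ {X Z : C} (δ : Bi E Z X),
    ∃ (Y : C) (x : X ⟶ Y) (y : Y ⟶ Z), Realizes x y δ
  /-- `𝔰(δ)` is exactly one equivalence class of sequences. -/
  realizes_iff : ∀ {X Y Y' Z : C} {x : X ⟶ Y} {y : Y ⟶ Z} {δ : Bi E Z X},
    Realizes x y δ → ∀ (x' : X ⟶ Y') (y' : Y' ⟶ Z),
      (Realizes x' y' δ ↔ ∃ b : Y ≅ Y', x ≫ b.hom = x' ∧ b.hom ≫ y' = y)
  /-- Every morphism of extensions is realized by a morphism of sequences. -/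
  realizes_hom : ∀ {X Y Z X' Y' Z' : C} {x : X ⟶ Y} {y : Y ⟶ Z} {δ : Bi E Z X}
    {x' : X' ⟶ Y'} {y' : Y' ⟶ Z'} {δ' : Bi E Z' X'},
    Realizes x y δ → Realizes x' y' δ' → ∀ (a : X ⟶ X') (c : Z ⟶ Z'),
      push E a δ = pull E c δ' → ∃ b : Y ⟶ Y', x ≫ b = a ≫ x' ∧ y ≫ c = b ≫ y'
  /-- (ET2) The realization is additive: the zero extension is realized by the split sequence. -/
  realizes_zero : ∀ {X Z : C} (b : BinaryBicone X Z), IsBiprod b → Realizes b.inl b.snd 0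
  /-- (ET2) The realization is additive: `𝔰(δ ⊕ δ') = 𝔰(δ) ⊕ 𝔰(δ')`, where
  `δ ⊕ δ' = ι₁ · δ · π₁ + ι₂ · δ' · π₂`. -/
  realizes_sum : ∀ {X Y Z X' Y' Z' : C} {x : X ⟶ Y} {y : Y ⟶ Z} {δ : Bi E Z X}
    {x' : X' ⟶ Y'} {y' : Y' ⟶ Z'} {δ' : Bi E Z' X'},
    Realizes x y δ → Realizes x' y' δ' →
    ∀ (bX : BinaryBicone X X') (bY : BinaryBicone Y Y') (bZ : BinaryBicone Z Z'),
      IsBiprod bX → IsBiprod bY → IsBiprod bZ →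
      Realizes (bX.fst ≫ x ≫ bY.inl + bX.snd ≫ x' ≫ bY.inr)
        (bY.fst ≫ y ≫ bZ.inl + bY.snd ≫ y' ≫ bZ.inr)
        (push E bX.inl (pull E bZ.fst δ) + push E bX.inr (pull E bZ.snd δ'))
  /-- (ET3) -/
  et3 : ∀ {X Y Z X' Y' Z' : C} {x : X ⟶ Y} {y : Y ⟶ Z} {δ : Bi E Z X}
    {x' : X' ⟶ Y'} {y' : Y' ⟶ Z'} {δ' : Bi E Z' X'},
    Realizes x y δ → Realizes x' y' δ' → ∀ (a : X ⟶ X') (b : Y ⟶ Y'), x ≫ b = a ≫ x' →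
      ∃ c : Z ⟶ Z', y ≫ c = b ≫ y' ∧ push E a δ = pull E c δ'
  /-- (ET3)ᵒᵖ -/
  et3_op : ∀ {X Y Z X' Y' Z' : C} {x : X ⟶ Y} {y : Y ⟶ Z} {δ : Bi E Z X}
    {x' : X' ⟶ Y'} {y' : Y' ⟶ Z'} {δ' : Bi E Z' X'},
    Realizes x y δ → Realizes x' y' δ' → ∀ (b : Y ⟶ Y') (c : Z ⟶ Z'), y ≫ c = b ≫ y' →
      ∃ a : X ⟶ X', x ≫ b = a ≫ x' ∧ push E a δ = pull E c δ'
  /-- (ET4) -/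
  et4 : ∀ {X Y D Z F : C} {f : X ⟶ Y} {f' : Y ⟶ D} {δ : Bi E D X}
    {g : Y ⟶ Z} {g' : Z ⟶ F} {δ' : Bi E F Y},
    Realizes f f' δ → Realizes g g' δ' →
      ∃ (W : C) (h' : Z ⟶ W) (d : D ⟶ W) (e : W ⟶ F) (δ'' : Bi E W X),
        Realizes (f ≫ g) h' δ'' ∧ f' ≫ d = g ≫ h' ∧ h' ≫ e = g' ∧
        Realizes d e (push E f' δ') ∧ pull E d δ'' = δ ∧ push E f δ'' = pull E e δ'
  /-- (ET4)ᵒᵖ -/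
  et4_op : ∀ {X Y D Z F : C} {f' : D ⟶ X} {f : X ⟶ Y} {δ : Bi E Y D}
    {g' : F ⟶ Y} {g : Y ⟶ Z} {δ' : Bi E Z F},
    Realizes f' f δ → Realizes g' g δ' →
      ∃ (W : C) (h' : W ⟶ X) (d : D ⟶ W) (e : W ⟶ F) (δ'' : Bi E Z W),
        Realizes h' (f ≫ g) δ'' ∧ h' ≫ f = e ≫ g' ∧ d ≫ h' = f' ∧
        Realizes d e (pull E g' δ) ∧ push E e δ'' = δ' ∧ push E d δ = pull E g δ''

namespace ExtriangulatedStructure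

section Basic

variable {C : Type u} [Category.{v} C] [Preadditive C] [HasZeroObject C] [HasBinaryBiproducts C]
  (ℰ : ExtriangulatedStructure C)

/-- `X ⟶ Y ⟶ Z` is an `𝔰`-conflation. -/
def Conflation {X Y Z : C} (x : X ⟶ Y) (y : Y ⟶ Z) : Prop :=
  ∃ δ : Bi ℰ.E Z X, ℰ.Realizes x y δ

/-- `𝔰`-inflations. -/
def Inflation {X Y : C} (x : X ⟶ Y) : Prop :=
  ∃ (Z : C) (y : Y ⟶ Z), ℰ.Conflation x y

/-- `𝔰`-deflations. -/
def Deflation {Y Z : C} (y : Y ⟶ Z) : Prop :=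
  ∃ (X : C) (x : X ⟶ Y), ℰ.Conflation x y

/-- The WIC condition. -/
def WIC : Prop :=
  (∀ {X Y Z : C} (f : X ⟶ Y) (g : Y ⟶ Z), ℰ.Inflation (f ≫ g) → ℰ.Inflation f) ∧
    (∀ {X Y Z : C} (f : X ⟶ Y) (g : Y ⟶ Z), ℰ.Deflation (f ≫ g) → ℰ.Deflation g)

/-- `P ⋆ Q`: the objects `B` admitting a conflation `X ⟶ B ⟶ Y` with `X ∈ P` and `Y ∈ Q`. -/
def star (P Q : ObjectProperty C) : ObjectProperty C := fun B =>
  ∃ (X Y : C) (x : X ⟶ B) (y : B ⟶ Y), P X ∧ Q Y ∧ ℰ.Conflation x y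

/-- The opposite of the bifunctor `𝔼`: `𝔼ᵒᵖ(op X, op Y) = 𝔼(Y, X)`. -/
abbrev opE : Cᵒᵖᵒᵖ ⥤ Cᵒᵖ ⥤ AddCommGrpCat.{v} := unopUnop C ⋙ ℰ.E.flip

/-- The opposite extriangulated category: `op Z ⟶ op Y ⟶ op X` realizes `δ` in `Cᵒᵖ` when
`X ⟶ Y ⟶ Z` realizes `δ` in `C`. -/
def op : ExtriangulatedStructure Cᵒᵖ where
  E := ℰ.opE
  additive_left := by
    have := ℰ.additive_right
    refine ⟨fun {X Y f g} => ?_⟩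
    ext Z : 2
    exact (ℰ.E.obj Z).map_add
  additive_right X := by
    have := ℰ.additive_left
    refine ⟨fun {Y Z f g} => ?_⟩
    exact congrArg (fun t => t.app X.unop.unop) (ℰ.E.map_add (f := f) (g := g))
  Realizes x y δ := ℰ.Realizes y.unop x.unop δ
  exists_realizes δ := by
    obtain ⟨Y, x, y, h⟩ := ℰ.exists_realizes δ
    exact ⟨Opposite.op Y, y.op, x.op, h⟩
  realizes_iff h x' y' := by
    rw [ℰ.realizes_iff h]
    constructor
    · rintro ⟨b, h₁, h₂⟩
      exact ⟨b.symm.op, Quiver.Hom.unop_inj (by simp [← h₂]),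
        Quiver.Hom.unop_inj (by simp [← h₁])⟩
    · rintro ⟨b, rfl, rfl⟩
      exact ⟨b.unop.symm, by simp [← unop_comp], by simp [← unop_comp]⟩
  realizes_hom h h' a c e := by
    obtain ⟨b, h₁, h₂⟩ := ℰ.realizes_hom h' h c.unop a.unop e.symm
    exact ⟨b.op, Quiver.Hom.unop_inj h₂.symm, Quiver.Hom.unop_inj h₁.symm⟩
  realizes_zero b hb :=
    ℰ.realizes_zero
      { pt := b.pt.unop, fst := b.inr.unop, snd := b.inl.unop, inl := b.snd.unop, inr := b.fst.unop,
        inl_fst := by simp [← unop_comp], inl_snd := by simp [← unop_comp],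
        inr_fst := by simp [← unop_comp], inr_snd := by simp [← unop_comp] }
      ((add_comm _ _).trans (congrArg Quiver.Hom.unop hb))
  realizes_sum h h' bX bY bZ hX hY hZ := by
    have key := ℰ.realizes_sum h h' (unopBicone bZ) (unopBicone bY) (unopBicone bX)
      (unopBicone_isBiprod hZ) (unopBicone_isBiprod hY) (unopBicone_isBiprod hX)
    rw [push_pull, push_pull] at key
    simp only [unopBicone] at key
    simp only [unop_add, unop_comp, Category.assoc]
    exact key
  et3 h h' a b e := by
    obtain ⟨c, h₁, h₂⟩ := ℰ.et3_op h' h b.unop a.unop (congrArg Quiver.Hom.unop e).symm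
    exact ⟨c.op, Quiver.Hom.unop_inj h₁.symm, h₂.symm⟩
  et3_op h h' b c e := by
    obtain ⟨a, h₁, h₂⟩ := ℰ.et3 h' h c.unop b.unop (congrArg Quiver.Hom.unop e).symm
    exact ⟨a.op, Quiver.Hom.unop_inj h₁.symm, h₂.symm⟩
  et4 h h' := by
    obtain ⟨W, h₀, d, e, δ, h₁, h₂, h₃, h₄, h₅, h₆⟩ := ℰ.et4_op h' h
    exact ⟨Opposite.op W, h₀.op, e.op, d.op, δ, h₁, Quiver.Hom.unop_inj h₂.symm,
      Quiver.Hom.unop_inj h₃, h₄, h₅, h₆.symm⟩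
  et4_op h h' := by
    obtain ⟨W, h₀, d, e, δ, h₁, h₂, h₃, h₄, h₅, h₆⟩ := ℰ.et4 h' h
    exact ⟨Opposite.op W, h₀.op, e.op, d.op, δ, h₁, Quiver.Hom.unop_inj h₂.symm,
      Quiver.Hom.unop_inj h₃, h₄, h₅, h₆.symm⟩

end Basic

/-! ## Extriangulated functors and one-sided exact functors -/

section Functors

variable {C : Type u₁} [Category.{v} C] [Preadditive C] [HasZeroObject C] [HasBinaryBiproducts C]
  {D : Type u₂} [Category.{v} D] [Preadditive D] [HasZeroObject D] [HasBinaryBiproducts D]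

/-- The additive functor `F` is extriangulated: there is a natural transformation
`Γ : 𝔼(?, -) ⟶ 𝔽(F ?, F -)` such that `𝔱(Γ(δ)) = F(𝔰(δ))`. -/
def IsExtriangulated (ℰ : ExtriangulatedStructure C) (ℱ : ExtriangulatedStructure D)
    (F : C ⥤ D) : Prop :=
  F.Additive ∧ ∃ Γ : ∀ X Y : C, Bi ℰ.E X Y →+ Bi ℱ.E (F.obj X) (F.obj Y),
    (∀ {X X' Y Y' : C} (c : X' ⟶ X) (a : Y ⟶ Y') (δ : Bi ℰ.E X Y),
      Γ X' Y' (push ℰ.E a (pull ℰ.E c δ)) =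
        push ℱ.E (F.map a) (pull ℱ.E (F.map c) (Γ X Y δ))) ∧
    (∀ {X Y Z : C} (x : X ⟶ Y) (y : Y ⟶ Z) (δ : Bi ℰ.E Z X),
      ℰ.Realizes x y δ → ℱ.Realizes (F.map x) (F.map y) (Γ Z X δ))

/-- The additive functor `F` is right exact. -/
def IsRightExact (ℰ : ExtriangulatedStructure C) (ℱ : ExtriangulatedStructure D)
    (F : C ⥤ D) : Prop :=
  F.Additive ∧ ∀ {C₁ C₀ C₂ : C} (a : C₁ ⟶ C₀) (b : C₀ ⟶ C₂), ℰ.Conflation a b →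
    ∃ (B₁ B₂ : D) (w : B₁ ⟶ F.obj C₁) (x : F.obj C₁ ⟶ B₂) (y : B₂ ⟶ F.obj C₀),
      ℱ.Conflation w x ∧ ℱ.Conflation y (F.map b) ∧ x ≫ y = F.map a

/-- The additive functor `F` is left exact. -/
def IsLeftExact (ℰ : ExtriangulatedStructure C) (ℱ : ExtriangulatedStructure D)
    (F : C ⥤ D) : Prop :=
  F.Additive ∧ ∀ {C₁ C₀ C₂ : C} (a : C₁ ⟶ C₀) (b : C₀ ⟶ C₂), ℰ.Conflation a b →
    ∃ (B₁ B₂ : D) (x : F.obj C₀ ⟶ B₁) (y : B₁ ⟶ F.obj C₂) (w : F.obj C₂ ⟶ B₂),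
      ℱ.Conflation (F.map a) x ∧ ℱ.Conflation y w ∧ x ≫ y = F.map b

end Functors

/-! ## The conditions AET3, AET4 and their duals -/

section AET

/-- AET3: all coproducts indexed by non-empty sets exist. -/
def AET3 (C : Type u) [Category.{v} C] : Prop :=
  ∀ (I : Type v) [Nonempty I], HasCoproductsOfShape I C

/-- AET3*: all products indexed by non-empty sets exist. -/
def AET3Star (C : Type u) [Category.{v} C] : Prop :=
  ∀ (I : Type v) [Nonempty I], HasProductsOfShape I C

variable {C : Type u} [Category.{v} C] [Preadditive C] [HasZeroObject C] [HasBinaryBiproducts C]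
  (ℰ : ExtriangulatedStructure C)

/-- AET4(`I`): coproducts indexed by `I` exist, and there is a natural transformation
`Γ : ∏ᵢ 𝔼(Bᵢ, A) ⟶ 𝔼(∐ᵢ Bᵢ, A^(I))` such that coproducts are extriangulated and coproduct
inclusions are extriangulated. -/
def AET4At (I : Type v) : Prop :=
  ∃ (_ : HasCoproductsOfShape I C)
    (Γ : ∀ (B : I → C) (A : C), (∀ i, Bi ℰ.E (B i) A) →+ Bi ℰ.E (∐ B) (∐ fun _ : I => A)),
    (∀ {B B' : I → C} {A A' : C} (c : ∀ i, B' i ⟶ B i) (a : A ⟶ A') (η : ∀ i, Bi ℰ.E (B i) A),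
      Γ B' A' (fun i => push ℰ.E a (pull ℰ.E (c i) (η i))) =
        push ℰ.E (Limits.Sigma.map fun _ => a) (pull ℰ.E (Limits.Sigma.map c) (Γ B A η))) ∧
    (∀ {B : I → C} {A : C} (η : ∀ i, Bi ℰ.E (B i) A) (M : I → C)
      (f : ∀ i, A ⟶ M i) (g : ∀ i, M i ⟶ B i), (∀ i, ℰ.Realizes (f i) (g i) (η i)) →
        ℰ.Realizes (Limits.Sigma.map f) (Limits.Sigma.map g) (Γ B A η)) ∧
    (∀ {B : I → C} {A : C} (η : ∀ i, Bi ℰ.E (B i) A) (i : I),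
      pull ℰ.E (Limits.Sigma.ι B i) (Γ B A η) =
        push ℰ.E (Limits.Sigma.ι (fun _ : I => A) i) (η i))

/-- AET4. -/
def AET4 : Prop := ∀ (I : Type v) [Nonempty I], ℰ.AET4At I

/-- AET4*: the opposite category is AET4. -/
def AET4Star : Prop := ℰ.op.AET4

/-- A negative first extension structure on an extriangulated category: a biadditive functor
`𝔼⁻¹` and, for each `δ ∈ 𝔼(Z, X)`, natural transformations `𝔼⁻¹(-, Z) ⟶ C(-, X)` and
`𝔼⁻¹(X, -) ⟶ C(Z, -)` making the sequences
`𝔼⁻¹(W,X) ⟶ 𝔼⁻¹(W,Y) ⟶ 𝔼⁻¹(W,Z) ⟶ C(W,X) ⟶ C(W,Y)` and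
`𝔼⁻¹(Z,W) ⟶ 𝔼⁻¹(Y,W) ⟶ 𝔼⁻¹(X,W) ⟶ C(Z,W) ⟶ C(Y,W)` exact for each realization
`X ⟶ Y ⟶ Z` of `δ`. -/
structure NegativeFirstExtension where
  /-- The bifunctor `𝔼⁻¹`. -/
  N : Cᵒᵖ ⥤ C ⥤ AddCommGrpCat.{v}
  additive_left : N.Additive
  additive_right : ∀ X : Cᵒᵖ, (N.obj X).Additive
  /-- The natural transformation `𝔼⁻¹(-, Z) ⟶ C(-, X)` attached to `δ`. -/
  lower : ∀ {X Z : C}, Bi ℰ.E Z X → ∀ W : C, Bi N W Z →+ (W ⟶ X)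
  lower_natural : ∀ {X Z : C} (δ : Bi ℰ.E Z X) {W W' : C} (w : W' ⟶ W) (χ : Bi N W Z),
    lower δ W' (pull N w χ) = w ≫ lower δ W χ
  /-- The natural transformation `𝔼⁻¹(X, -) ⟶ C(Z, -)` attached to `δ`. -/
  upper : ∀ {X Z : C}, Bi ℰ.E Z X → ∀ W : C, Bi N X W →+ (Z ⟶ W)
  upper_natural : ∀ {X Z : C} (δ : Bi ℰ.E Z X) {W W' : C} (w : W ⟶ W') (χ : Bi N X W),
    upper δ W' (push N w χ) = upper δ W χ ≫ w
  lower_exact : ∀ {X Y Z : C} (x : X ⟶ Y) (y : Y ⟶ Z) (δ : Bi ℰ.E Z X), ℰ.Realizes x y δ →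
    ∀ W : C,
      Function.Exact (push N x : Bi N W X → Bi N W Y) (push N y : Bi N W Y → Bi N W Z) ∧
      Function.Exact (push N y : Bi N W Y → Bi N W Z) (lower δ W) ∧
      Function.Exact (lower δ W) (fun f : W ⟶ X => f ≫ x)
  upper_exact : ∀ {X Y Z : C} (x : X ⟶ Y) (y : Y ⟶ Z) (δ : Bi ℰ.E Z X), ℰ.Realizes x y δ →
    ∀ W : C,
      Function.Exact (pull N y : Bi N Z W → Bi N Y W) (pull N x : Bi N Y W → Bi N X W) ∧
      Function.Exact (pull N x : Bi N Y W → Bi N X W) (upper δ W) ∧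
      Function.Exact (upper δ W) (fun f : Z ⟶ W => y ≫ f)

/-- Coproduct-compatible extriangulated categories. -/
def CoproductCompatible : Prop :=
  ∃ (_ : AET3 C) (𝒩 : ℰ.NegativeFirstExtension),
    ∀ (I : Type v) [Nonempty I] (_ : HasCoproductsOfShape I C) (Y : I → C) (X : C),
      Function.Surjective fun (χ : Bi 𝒩.N (∐ Y) X) (i : I) =>
        (pull 𝒩.N (Limits.Sigma.ι Y i) χ : Bi 𝒩.N (Y i) X)

/-- Product-compatible extriangulated categories. -/
def ProductCompatible : Prop :=
  ∃ (_ : AET3Star C) (𝒩 : ℰ.NegativeFirstExtension),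
    ∀ (I : Type v) [Nonempty I] (_ : HasProductsOfShape I C) (Y : I → C) (X : C),
      Function.Surjective fun (χ : Bi 𝒩.N X (∏ᶜ Y)) (i : I) =>
        (push 𝒩.N (Limits.Pi.π Y i) χ : Bi 𝒩.N X (Y i))

end AET

end ExtriangulatedStructure

/-! ## Recollements -/

section Recollement

/-- The kernel of a functor: the objects sent to zero. -/
def kerObj {C : Type u₁} [Category.{v} C] {D : Type u₂} [Category.{v} D] (F : C ⥤ D) :
    ObjectProperty C := fun X => IsZero (F.obj X)

variable {A : Type u₁} [Category.{v} A] [Preadditive A] [HasZeroObject A] [HasBinaryBiproducts A]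
  {B : Type u₂} [Category.{v} B] [Preadditive B] [HasZeroObject B] [HasBinaryBiproducts B]
  {C : Type u₃} [Category.{v} C] [Preadditive C] [HasZeroObject C] [HasBinaryBiproducts C]

/-- A recollement of the additive category `B` by the additive categories `A` and `C`, with
`iL = i^*`, `i = i_*`, `iR = i^!`, `jL = j_!`, `j = j^*`, `jR = j_*`. -/
structure AdditiveRecollement (A : Type u₁) [Category.{v} A] [Preadditive A] [HasZeroObject A]
    [HasBinaryBiproducts A] (B : Type u₂) [Category.{v} B] [Preadditive B] [HasZeroObject B]
    [HasBinaryBiproducts B] (C : Type u₃) [Category.{v} C] [Preadditive C] [HasZeroObject C]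
    [HasBinaryBiproducts C] where
  iL : B ⥤ A
  i : A ⥤ B
  iR : B ⥤ A
  jL : C ⥤ B
  j : B ⥤ C
  jR : C ⥤ B
  iL_additive : iL.Additive
  i_additive : i.Additive
  iR_additive : iR.Additive
  jL_additive : jL.Additive
  j_additive : j.Additive
  jR_additive : jR.Additive
  /-- (AR1) -/
  iL_adj_i : iL ⊣ i
  i_adj_iR : i ⊣ iR
  jL_adj_j : jL ⊣ j
  j_adj_jR : j ⊣ jR
  /-- (AR2) -/
  i_full : i.Full
  i_faithful : i.Faithful
  jL_full : jL.Full
  jL_faithful : jL.Faithful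
  jR_full : jR.Full
  jR_faithful : jR.Faithful
  /-- (AR3) `Im i_* = Ker j^*` -/
  image_eq_kernel : i.essImage = kerObj j

/-- A recollement of extriangulated categories. -/
structure Recollement (ℰA : ExtriangulatedStructure A) (ℰB : ExtriangulatedStructure B)
    (ℰC : ExtriangulatedStructure C) extends AdditiveRecollement A B C where
  /-- (ER4) -/
  iL_rightExact : ExtriangulatedStructure.IsRightExact ℰB ℰA iL
  jL_rightExact : ExtriangulatedStructure.IsRightExact ℰC ℰB jL
  /-- (ER5) -/
  iR_leftExact : ExtriangulatedStructure.IsLeftExact ℰB ℰA iR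
  jR_leftExact : ExtriangulatedStructure.IsLeftExact ℰC ℰB jR
  /-- (ER6) -/
  i_extriangulated : ExtriangulatedStructure.IsExtriangulated ℰA ℰB i
  j_extriangulated : ExtriangulatedStructure.IsExtriangulated ℰB ℰC j
  /-- (ER7) `(Ker i^*, Im i_*, Ker i^!)` is a TTF triple in `B`. -/
  hom_image_ker : ∀ {X Y : B}, i.essImage X → kerObj iR Y → ∀ f : X ⟶ Y, f = 0
  hom_ker_image : ∀ {X Y : B}, kerObj iL X → i.essImage Y → ∀ f : X ⟶ Y, f = 0
  ker_star_image : ∀ X : B, ℰB.star (kerObj iL) i.essImage X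
  image_star_ker : ∀ X : B, ℰB.star i.essImage (kerObj iR) X

end Recollement

end Extri

/-! The key point is a natural isomorphism `𝔼(jL X, jR Y) ≅ 𝔼(X, Y)`: apply `j`, then identify `j jL
X` with `X` and `j jR Y` with `Y` by the unit and counit, which are invertible because `jL` and `jR`
are fully faithful (`adjointExtMap_bijective`). Injectivity transposes a splitting along `jL ⊣ j`.
Surjectivity uses that the right exact functor `jL` preserves deflations, and transposes along `j ⊣
jR`.

Given extensions `ηᵢ` in `C`, lift them through this isomorphism to `B`, take their coproduct there
by AET4, and apply `j`. As a left adjoint, `j` preserves coproducts, so the result lives in `𝔼(∐ Xᵢ,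
A^(I))` up to canonical isomorphism, and the AET4 conditions pass from `B` to `C`
(`AET4At.of_adjointTriple`). The product version is the same argument for the opposite triple `jR.op
⊣ j.op ⊣ jL.op`. -/

namespace Extri

/-! ### Functoriality of the two actions on extensions -/

section Bifunctor

variable {C : Type u} [Category.{v} C] (F : Cᵒᵖ ⥤ C ⥤ AddCommGrpCat.{v})

theorem push_id {X Y : C} (δ : Bi F X Y) : push F (𝟙 Y) δ = δ := by
  simp [push]

theorem pull_id {X Y : C} (δ : Bi F X Y) : pull F (𝟙 X) δ = δ := by
  simp [pull]

theorem push_comp {X Y Y' Y'' : C} (a : Y ⟶ Y') (b : Y' ⟶ Y'') (δ : Bi F X Y) :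
    push F (a ≫ b) δ = push F b (push F a δ) := by
  simp [push]

theorem pull_comp {X X' X'' Y : C} (c : X' ⟶ X) (d : X'' ⟶ X') (δ : Bi F X Y) :
    pull F (d ≫ c) δ = pull F d (pull F c δ) := by
  simp [pull]

end Bifunctor

namespace ExtriangulatedStructure

/-! ### Conflations: transport along isomorphisms and splitting -/

section Basic

variable {C : Type u} [Category.{v} C] [Preadditive C] [HasZeroObject C] [HasBinaryBiproducts C]
  (ℰ : ExtriangulatedStructure C)

open scoped ZeroObject in
-- A test conflation: comparing it with another one through (ET3) or its dual yields factorizations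
-- and vanishing of extensions.
theorem realizes_zero_id (W : C) : ℰ.Realizes (0 : (0 : C) ⟶ W) (𝟙 W) 0 :=
  ℰ.realizes_zero
    { pt := W, fst := 0, snd := 𝟙 W, inl := 0, inr := 𝟙 W
      inl_fst := (isZero_zero C).eq_of_src _ _
      inl_snd := by simp
      inr_fst := by simp
      inr_snd := by simp } (by simp [IsBiprod])

variable {ℰ}

/-- The second map of a conflation is a weak cokernel of the first. -/
theorem Realizes.exists_desc {X Y Z W : C} {x : X ⟶ Y} {y : Y ⟶ Z} {δ : Bi ℰ.E Z X}
    (h : ℰ.Realizes x y δ) (f : Y ⟶ W) (hf : x ≫ f = 0) : ∃ g : Z ⟶ W, y ≫ g = f := by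
  obtain ⟨c, hc, -⟩ := ℰ.et3 h (ℰ.realizes_zero_id W) 0 f (by simp [hf])
  exact ⟨c, by simpa using hc⟩

/-- An endomorphism of the middle term of a conflation that is the identity on both ends is
invertible. -/
theorem Realizes.isIso_of_id {X Y Z : C} {x : X ⟶ Y} {y : Y ⟶ Z} {δ : Bi ℰ.E Z X}
    (h : ℰ.Realizes x y δ) (φ : Y ⟶ Y) (h₁ : x ≫ φ = x) (h₂ : φ ≫ y = y) : IsIso φ := by
  obtain ⟨t, ht⟩ := Realizes.exists_desc h (φ - 𝟙 Y) (by simp [h₁])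
  -- The second factor passes through `y`, and `y` kills the first, so `φ - 𝟙` squares to zero and
  -- `φ` has inverse `2 - φ`.
  have hsq : (φ - 𝟙 Y) ≫ (φ - 𝟙 Y) = 0 := by
    nth_rw 2 [← ht]
    rw [← Category.assoc, Preadditive.sub_comp, h₂]
    simp
  have hφ : φ ≫ φ = φ + φ - 𝟙 Y := by
    simp only [Preadditive.sub_comp, Preadditive.comp_sub, Category.comp_id,
      Category.id_comp] at hsq
    rw [← sub_eq_zero, ← hsq]
    abel
  refine ⟨𝟙 Y + 𝟙 Y - φ, ?_, ?_⟩ <;>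
  · simp only [Preadditive.sub_comp, Preadditive.comp_sub, Preadditive.add_comp,
      Preadditive.comp_add, Category.comp_id, Category.id_comp, hφ]
    abel

/-- Transport of a realization along isomorphisms of the two ends. -/
theorem Realizes.transport {X X' Y Z Z' : C} {x : X ⟶ Y} {y : Y ⟶ Z} {δ : Bi ℰ.E Z X}
    (h : ℰ.Realizes x y δ) (a : X ≅ X') (c : Z' ≅ Z) :
    ℰ.Realizes (a.inv ≫ x) (y ≫ c.inv) (push ℰ.E a.hom (pull ℰ.E c.hom δ)) := by
  -- Compare with an arbitrary realization of the transported extension: lifts in both directions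
  -- compose to endomorphisms fixing the ends, hence to isomorphisms.
  obtain ⟨Y', x', y', h'⟩ := ℰ.exists_realizes (push ℰ.E a.hom (pull ℰ.E c.hom δ))
  obtain ⟨b, hb₁, hb₂⟩ := ℰ.realizes_hom h h' a.hom c.inv (by
    rw [← push_pull, ← pull_comp, c.inv_hom_id, pull_id])
  obtain ⟨b', hb'₁, hb'₂⟩ := ℰ.realizes_hom h' h a.inv c.hom (by
    rw [← push_comp, a.hom_inv_id, push_id])
  have i₁ : IsIso (b ≫ b') := Realizes.isIso_of_id h _
    (by rw [reassoc_of% hb₁, hb'₁, a.hom_inv_id_assoc])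
    (by rw [Category.assoc, ← hb'₂, ← reassoc_of% hb₂, c.inv_hom_id, Category.comp_id])
  have i₂ : IsIso (b' ≫ b) := Realizes.isIso_of_id h' _
    (by rw [reassoc_of% hb'₁, hb₁, a.inv_hom_id_assoc])
    (by rw [Category.assoc, ← hb₂, ← reassoc_of% hb'₂, c.hom_inv_id, Category.comp_id])
  have : Mono b := mono_of_mono b b'
  have : IsSplitEpi b := .mk' ⟨inv (b' ≫ b) ≫ b', by simp⟩
  have : IsIso b := isIso_of_mono_of_isSplitEpi b
  refine (ℰ.realizes_iff h' _ _).2 ⟨(asIso b).symm, ?_, ?_⟩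
  · simp [IsIso.comp_inv_eq, hb₁]
  · simp [hb₂]

/-- A zero extension has a split deflation. -/
theorem Realizes.exists_section {X Y Z : C} {x : X ⟶ Y} {y : Y ⟶ Z}
    (h : ℰ.Realizes x y 0) : ∃ s : Z ⟶ Y, s ≫ y = 𝟙 Z := by
  have hb : ℰ.Realizes (biprod.inl : X ⟶ X ⊞ Z) biprod.snd 0 :=
    ℰ.realizes_zero (BinaryBiproduct.bicone X Z) biprod.total
  obtain ⟨b, -, hb⟩ := (ℰ.realizes_iff hb x y).1 h
  exact ⟨biprod.inr ≫ b.hom, by rw [Category.assoc, hb, biprod.inr_snd]⟩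

/-- An extension whose deflation splits is zero. -/
theorem Realizes.eq_zero_of_section {X Y Z : C} {x : X ⟶ Y} {y : Y ⟶ Z} {δ : Bi ℰ.E Z X}
    (h : ℰ.Realizes x y δ) (s : Z ⟶ Y) (hs : s ≫ y = 𝟙 Z) : δ = 0 := by
  -- The section gives a morphism from `0 ⟶ Z ⟶ Z` to the given conflation that is the identity on
  -- `Z`, so `δ` is a pushforward of zero.
  obtain ⟨a, -, ha⟩ := ℰ.et3_op (ℰ.realizes_zero_id Z) h s (𝟙 Z) (by simp [hs])
  rw [map_zero, pull_id] at ha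
  exact ha.symm

end Basic

/-! ### Extensions along an adjoint triple and descent of AET4 -/

section AdjointTriple

variable {B : Type u₂} [Category.{v} B] [Preadditive B] [HasZeroObject B] [HasBinaryBiproducts B]
  {C : Type u₃} [Category.{v} C] [Preadditive C] [HasZeroObject C] [HasBinaryBiproducts C]
  {ℰB : ExtriangulatedStructure B} {ℰC : ExtriangulatedStructure C}
  {jL jR : C ⥤ B} {j : B ⥤ C}

/-- For an adjoint triple `jL ⊣ j ⊣ jR` and an action `Γ` of `j` on extensions, the induced map
`𝔼(jL X, jR Y) ⟶ 𝔼(X, Y)`. -/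
def adjointExtMap (adjL : jL ⊣ j) (adjR : j ⊣ jR)
    (Γ : ∀ X Y : B, Bi ℰB.E X Y →+ Bi ℰC.E (j.obj X) (j.obj Y)) (X Y : C) :
    Bi ℰB.E (jL.obj X) (jR.obj Y) →+ Bi ℰC.E X Y :=
  ((push ℰC.E (adjR.counit.app Y)).comp (pull ℰC.E (adjL.unit.app X))).comp
    (Γ (jL.obj X) (jR.obj Y))

theorem adjointExtMap_apply (adjL : jL ⊣ j) (adjR : j ⊣ jR)
    (Γ : ∀ X Y : B, Bi ℰB.E X Y →+ Bi ℰC.E (j.obj X) (j.obj Y)) (X Y : C)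
    (δ : Bi ℰB.E (jL.obj X) (jR.obj Y)) :
    adjointExtMap adjL adjR Γ X Y δ =
      push ℰC.E (adjR.counit.app Y) (pull ℰC.E (adjL.unit.app X) (Γ _ _ δ)) := rfl

theorem adjointExtMap_natural (adjL : jL ⊣ j) (adjR : j ⊣ jR)
    {Γ : ∀ X Y : B, Bi ℰB.E X Y →+ Bi ℰC.E (j.obj X) (j.obj Y)}
    (hΓ : ∀ {X X' Y Y' : B} (c : X' ⟶ X) (a : Y ⟶ Y') (δ : Bi ℰB.E X Y),
      Γ X' Y' (push ℰB.E a (pull ℰB.E c δ)) =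
        push ℰC.E (j.map a) (pull ℰC.E (j.map c) (Γ X Y δ)))
    {X X' Y Y' : C} (c : X' ⟶ X) (a : Y ⟶ Y') (δ : Bi ℰB.E (jL.obj X) (jR.obj Y)) :
    adjointExtMap adjL adjR Γ X' Y' (push ℰB.E (jR.map a) (pull ℰB.E (jL.map c) δ)) =
      push ℰC.E a (pull ℰC.E c (adjointExtMap adjL adjR Γ X Y δ)) := by
  have hL : c ≫ adjL.unit.app X = adjL.unit.app X' ≫ j.map (jL.map c) := adjL.unit.naturality c
  have hR : j.map (jR.map a) ≫ adjR.counit.app Y' = adjR.counit.app Y ≫ a :=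
    adjR.counit.naturality a
  simp only [adjointExtMap_apply, hΓ, ← push_pull, ← push_comp, ← pull_comp, hL, hR]

theorem Realizes.adjointExtMap (adjL : jL ⊣ j) (adjR : j ⊣ jR) [IsIso adjL.unit]
    [IsIso adjR.counit]
    {Γ : ∀ X Y : B, Bi ℰB.E X Y →+ Bi ℰC.E (j.obj X) (j.obj Y)}
    (hreal : ∀ {X Y Z : B} (x : X ⟶ Y) (y : Y ⟶ Z) (δ : Bi ℰB.E Z X),
      ℰB.Realizes x y δ → ℰC.Realizes (j.map x) (j.map y) (Γ Z X δ)) {X Y : C} {M : B}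
    {x : jR.obj Y ⟶ M} {y : M ⟶ jL.obj X} {δ : Bi ℰB.E (jL.obj X) (jR.obj Y)}
    (h : ℰB.Realizes x y δ) :
    ℰC.Realizes (X := Y) (Z := X) (inv (adjR.counit.app Y) ≫ j.map x)
      (j.map y ≫ inv (adjL.unit.app X)) (adjointExtMap adjL adjR Γ X Y δ) :=
  Realizes.transport (hreal x y δ h) (asIso (adjR.counit.app Y)) (asIso (adjL.unit.app X))

/-- The map `𝔼(jL X, jR Y) ⟶ 𝔼(X, Y)` is bijective when `jL` is fully faithful and preserves
deflations. -/
theorem adjointExtMap_bijective (adjL : jL ⊣ j) (adjR : j ⊣ jR) [IsIso adjL.unit]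
    [IsIso adjR.counit]
    (hdefl : ∀ {X Y : C} (g : X ⟶ Y), ℰC.Deflation g → ℰB.Deflation (jL.map g))
    {Γ : ∀ X Y : B, Bi ℰB.E X Y →+ Bi ℰC.E (j.obj X) (j.obj Y)}
    (hΓ : ∀ {X X' Y Y' : B} (c : X' ⟶ X) (a : Y ⟶ Y') (δ : Bi ℰB.E X Y),
      Γ X' Y' (push ℰB.E a (pull ℰB.E c δ)) =
        push ℰC.E (j.map a) (pull ℰC.E (j.map c) (Γ X Y δ)))
    (hreal : ∀ {X Y Z : B} (x : X ⟶ Y) (y : Y ⟶ Z) (δ : Bi ℰB.E Z X),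
      ℰB.Realizes x y δ → ℰC.Realizes (j.map x) (j.map y) (Γ Z X δ)) (X Y : C) :
    Function.Bijective (adjointExtMap adjL adjR Γ X Y) := by
  constructor
  · rw [injective_iff_map_eq_zero]
    intro δ hδ
    obtain ⟨M, x, y, h⟩ := ℰB.exists_realizes δ
    have hM := Realizes.adjointExtMap adjL adjR hreal h
    rw [hδ] at hM
    obtain ⟨s, hs⟩ := Realizes.exists_section hM
    -- The section `s` of the image deflation transposes to a section of `y` itself.
    refine Realizes.eq_zero_of_section h ((adjL.homEquiv X M).symm s) ?_
    apply (adjL.homEquiv X _).injective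
    rw [adjL.homEquiv_naturality_right, Equiv.apply_symm_apply, adjL.homEquiv_id]
    simpa [← Category.assoc, IsIso.comp_inv_eq] using hs
  · intro η
    obtain ⟨M, f, g, h⟩ := ℰC.exists_realizes η
    -- Complete `jL g` to a conflation starting at some `Q`. Its image under `j` maps to the given
    -- conflation by the inverse units, inducing `a : j Q ⟶ Y`; the preimage of `η` is `δ` pushed
    -- along the transpose `Q ⟶ jR Y` of `a`.
    obtain ⟨Q, q, δ, hδ⟩ := hdefl g ⟨_, f, η, h⟩
    obtain ⟨a, -, ha⟩ := ℰC.et3_op (hreal _ _ _ hδ) h (inv (adjL.unit.app M))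
      (inv (adjL.unit.app X)) (by
        rw [IsIso.comp_inv_eq, Category.assoc, IsIso.eq_inv_comp]
        exact (adjL.unit.naturality g).symm)
    refine ⟨push ℰB.E (adjR.homEquiv Q Y a) δ, ?_⟩
    have hΓ' : Γ _ _ (push ℰB.E (adjR.homEquiv Q Y a) δ) =
        push ℰC.E (j.map (adjR.homEquiv Q Y a)) (Γ _ _ δ) := by
      simpa only [pull_id, j.map_id] using hΓ (𝟙 _) (adjR.homEquiv Q Y a) δ
    have hcounit : j.map (adjR.homEquiv Q Y a) ≫ adjR.counit.app Y = a := by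
      exact (adjR.homEquiv_counit ..).symm.trans (Equiv.symm_apply_apply ..)
    rw [adjointExtMap_apply, hΓ', ← push_pull, ← push_comp, hcounit, push_pull, ha, ← pull_comp,
      IsIso.hom_inv_id]
    exact pull_id _ η

/-- AET4 descends along a functor `j` that acts on extensions and sits in an adjoint triple
`jL ⊣ j ⊣ jR` with `jL`, `jR` fully faithful and `jL` preserving deflations. -/
theorem AET4At.of_adjointTriple (adjL : jL ⊣ j) (adjR : j ⊣ jR) [IsIso adjL.unit]
    [IsIso adjR.counit]
    (hdefl : ∀ {X Y : C} (g : X ⟶ Y), ℰC.Deflation g → ℰB.Deflation (jL.map g))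
    (hj : IsExtriangulated ℰB ℰC j) {I : Type v} [HasCoproductsOfShape I C]
    (hB : ℰB.AET4At I) : ℰC.AET4At I := by
  obtain ⟨-, Γ, hΓ, hreal⟩ := hj
  obtain ⟨_, Δ, hΔ, hΔreal, hΔι⟩ := hB
  have : PreservesColimitsOfShape (Discrete I) j :=
    (adjR.leftAdjoint_preservesColimits).preservesColimitsOfShape
  let φ (X Y : C) := AddEquiv.ofBijective (adjointExtMap adjL adjR Γ X Y)
    (adjointExtMap_bijective adjL adjR hdefl hΓ hreal X Y)
  have hφ (X Y : C) (δ) : φ X Y δ = adjointExtMap adjL adjR Γ X Y δ := rfl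
  have hφ' (X Y : C) (η) : adjointExtMap adjL adjR Γ X Y ((φ X Y).symm η) = η :=
    (φ X Y).apply_symm_apply η
  have hφnat {X X' Y Y' : C} (c : X' ⟶ X) (a : Y ⟶ Y') (η : Bi ℰC.E X Y) :
      (φ X' Y').symm (push ℰC.E a (pull ℰC.E c η)) =
        push ℰB.E (jR.map a) (pull ℰB.E (jL.map c) ((φ X Y).symm η)) := by
    rw [AddEquiv.symm_apply_eq, hφ, adjointExtMap_natural adjL adjR hΓ, hφ']
  -- The identifications combine preservation of coproducts by `j` with the counit in `α` and the
  -- unit in `β`; `β` points towards the image of `j` because it acts contravariantly.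
  let α (A : C) : j.obj (∐ fun _ : I => jR.obj A) ≅ ∐ fun _ : I => A :=
    PreservesCoproduct.iso j _ ≪≫ Sigma.mapIso fun _ => asIso (adjR.counit.app A)
  let β (X : I → C) : ∐ X ≅ j.obj (∐ fun i => jL.obj (X i)) :=
    Sigma.mapIso (fun i => asIso (adjL.unit.app (X i))) ≪≫
      (PreservesCoproduct.iso j fun i => jL.obj (X i)).symm
  have ιcomp (Y : I → B) (i : I) :
      j.map (Sigma.ι Y i) ≫ (PreservesCoproduct.iso j Y).hom = Sigma.ι (fun i => j.obj (Y i)) i := by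
    rw [← Iso.eq_comp_inv, PreservesCoproduct.inv_hom, ι_comp_sigmaComparison]
  have hα (A : C) (i : I) : j.map (Sigma.ι (fun _ : I => jR.obj A) i) ≫ (α A).hom =
      adjR.counit.app A ≫ Sigma.ι (fun _ : I => A) i := by
    simp only [α, Iso.trans_hom]
    rw [reassoc_of% (ιcomp (fun _ : I => jR.obj A) i)]
    simp
  have hβ (X : I → C) (i : I) : Sigma.ι X i ≫ (β X).hom =
      adjL.unit.app (X i) ≫ j.map (Sigma.ι (fun i => jL.obj (X i)) i) := by
    simp [β]
  -- Since `j` preserves the coproduct, the images of the inclusions are jointly epimorphic.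
  have jext {Y : I → B} {W : C} {s t : j.obj (∐ Y) ⟶ W}
      (h : ∀ i, j.map (Sigma.ι Y i) ≫ s = j.map (Sigma.ι Y i) ≫ t) : s = t := by
    rw [← cancel_epi (PreservesCoproduct.iso j Y).inv]
    ext i
    simpa using h i
  have hαnat {A A' : C} (a : A ⟶ A') :
      j.map (Limits.Sigma.map fun _ : I => jR.map a) ≫ (α A').hom =
        (α A).hom ≫ Limits.Sigma.map fun _ : I => a := by
    apply jext
    intro i
    rw [← Category.assoc, ← Functor.map_comp, Sigma.ι_map, Functor.map_comp, Category.assoc, hα,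
      reassoc_of% hα, Sigma.ι_map]
    exact adjR.counit.naturality_assoc a _
  have hβnat {X X' : I → C} (c : ∀ i, X' i ⟶ X i) :
      Limits.Sigma.map c ≫ (β X).hom = (β X').hom ≫ j.map (Limits.Sigma.map fun i => jL.map (c i)) := by
    ext i
    rw [Sigma.ι_map_assoc, hβ, reassoc_of% hβ, ← Functor.map_comp, Sigma.ι_map, Functor.map_comp]
    exact adjL.unit.naturality_assoc (c i) _
  let Θ (X : I → C) (A : C) :
      (∀ i, Bi ℰC.E (X i) A) →+ Bi ℰC.E (∐ X) (∐ fun _ : I => A) :=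
    (((push ℰC.E (α A).hom).comp (pull ℰC.E (β X).hom)).comp (Γ _ _)).comp
      ((Δ (fun i => jL.obj (X i)) (jR.obj A)).comp
        { toFun := fun η i => (φ (X i) A).symm (η i)
          map_zero' := by funext i; exact map_zero _
          map_add' := fun η η' => by funext i; exact map_add _ _ _ })
  have hΘ (X : I → C) (A : C) (η) : Θ X A η = push ℰC.E (α A).hom (pull ℰC.E (β X).hom
      (Γ _ _ (Δ _ _ fun i => (φ (X i) A).symm (η i)))) := rfl
  refine ⟨inferInstance, Θ, ?_, ?_, ?_⟩
  · intro X X' A A' c a η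
    simp only [hΘ, hφnat, hΔ, hΓ]
    simp only [← push_pull, ← push_comp, ← pull_comp, hαnat, hβnat]
  · intro X A η M f g h
    choose N x y hxy using fun i => ℰB.exists_realizes ((φ (X i) A).symm (η i))
    -- The image of the lifted sequence and the given sequence both realize `η i`, hence are
    -- equivalent; the coproduct of these equivalences identifies the middle terms.
    have key (i : I) : ∃ b : j.obj (N i) ≅ M i,
        (inv (adjR.counit.app A) ≫ j.map (x i)) ≫ b.hom = f i ∧
          b.hom ≫ g i = j.map (y i) ≫ inv (adjL.unit.app (X i)) := by
      have hM := Realizes.adjointExtMap adjL adjR hreal (hxy i)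
      rw [hφ'] at hM
      exact (ℰC.realizes_iff hM _ _).1 (h i)
    choose b hb₁ hb₂ using key
    have hΘreal := Realizes.transport (hreal _ _ _ (hΔreal _ N x y hxy)) (α A) (β X)
    refine (ℰC.realizes_iff hΘreal _ _).2
      ⟨PreservesCoproduct.iso j N ≪≫ Sigma.mapIso b, ?_, ?_⟩
    · rw [Category.assoc, Iso.inv_comp_eq]
      apply jext
      intro i
      rw [← Category.assoc, ← Functor.map_comp, Sigma.ι_map, Functor.map_comp, Category.assoc,
        reassoc_of% hα, Sigma.ι_map, ← hb₁]
      simp only [Iso.trans_hom]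
      rw [reassoc_of% (ιcomp N i)]
      simp
    · rw [Iso.eq_comp_inv]
      apply jext
      intro i
      rw [← Functor.map_comp, Sigma.ι_map, Functor.map_comp]
      simp only [Iso.trans_hom, Category.assoc]
      rw [reassoc_of% (ιcomp N i)]
      have hmap : (Sigma.mapIso b).hom = Limits.Sigma.map fun i => (b i).hom := by
        ext i
        simp
      rw [hmap, Sigma.ι_map_assoc, Sigma.ι_map_assoc, hβ, reassoc_of% (hb₂ i), IsIso.inv_hom_id_assoc]
  · intro X A η i
    have h₁ : Γ _ _ (pull ℰB.E (Sigma.ι (fun i => jL.obj (X i)) i)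
        (Δ _ _ fun i => (φ (X i) A).symm (η i))) =
        pull ℰC.E (j.map (Sigma.ι (fun i => jL.obj (X i)) i))
          (Γ _ _ (Δ _ _ fun i => (φ (X i) A).symm (η i))) := by
      simpa only [push_id, j.map_id] using hΓ (Sigma.ι (fun i => jL.obj (X i)) i) (𝟙 _) _
    have h₂ : Γ _ _ (push ℰB.E (Sigma.ι (fun _ : I => jR.obj A) i) ((φ (X i) A).symm (η i))) =
        push ℰC.E (j.map (Sigma.ι (fun _ : I => jR.obj A) i)) (Γ _ _ ((φ (X i) A).symm (η i))) := by
      simpa only [pull_id, j.map_id] using hΓ (𝟙 _) (Sigma.ι (fun _ : I => jR.obj A) i) _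
    rw [hΘ, ← push_pull, ← pull_comp, hβ, pull_comp, ← h₁, hΔι, h₂, ← push_pull, ← push_comp, hα,
      push_comp, ← adjointExtMap_apply, hφ']

/-! ### One-sided exactness and passage to the opposite category -/

theorem IsRightExact.deflation {F : C ⥤ B} (hF : IsRightExact ℰC ℰB F) {X Y : C} (g : X ⟶ Y)
    (hg : ℰC.Deflation g) : ℰB.Deflation (F.map g) := by
  obtain ⟨_, f, h⟩ := hg
  obtain ⟨_, _, _, _, _, -, h', -⟩ := hF.2 f g h
  exact ⟨_, _, h'⟩

/-- Left exactness makes the image of an inflation an inflation, and inflations are the deflations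
of the opposite category. -/
theorem IsLeftExact.deflation_op {F : C ⥤ B} (hF : IsLeftExact ℰC ℰB F) {X Y : Cᵒᵖ} (g : X ⟶ Y)
    (hg : ℰC.op.Deflation g) : ℰB.op.Deflation (F.op.map g) := by
  obtain ⟨_, f, δ, h⟩ := hg
  obtain ⟨B₁, _, x, _, _, ⟨δ', h'⟩, -⟩ := hF.2 g.unop f.unop ⟨δ, h⟩
  exact ⟨Opposite.op B₁, x.op, δ', h'⟩

/-- Passing to opposites exchanges pushing and pulling, so naturality holds because the two actions
commute. -/
theorem IsExtriangulated.op {F : B ⥤ C} (hF : IsExtriangulated ℰB ℰC F) :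
    IsExtriangulated ℰB.op ℰC.op F.op := by
  obtain ⟨_, Γ, hΓ, hreal⟩ := hF
  refine ⟨inferInstance, fun X Y => Γ Y.unop X.unop, fun c a δ => ?_,
    fun x y δ h => hreal y.unop x.unop δ h⟩
  refine (congrArg _ (push_pull ℰB.op.E a c δ)).trans ((hΓ a.unop c.unop δ).trans ?_)
  exact (push_pull ℰC.op.E (F.op.map a) (F.op.map c) (Γ _ _ δ)).symm

end AdjointTriple

end ExtriangulatedStructure

end Extri

theorem mainTheorem5
    {A : Type u₁} [Category.{v} A] [Preadditive A] [HasZeroObject A] [HasBinaryBiproducts A]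
    {B : Type u₂} [Category.{v} B] [Preadditive B] [HasZeroObject B] [HasBinaryBiproducts B]
    {C : Type u₃} [Category.{v} C] [Preadditive C] [HasZeroObject C] [HasBinaryBiproducts C]
    (ℰA : Extri.ExtriangulatedStructure A) (ℰB : Extri.ExtriangulatedStructure B)
    (ℰC : Extri.ExtriangulatedStructure C) (R : Extri.Recollement ℰA ℰB ℰC) :
    (ℰC.CoproductCompatible → ℰB.AET4 → ℰB.WIC → ℰC.AET4) ∧
      (ℰC.ProductCompatible → ℰB.AET4Star → ℰB.WIC → ℰC.AET4Star) := by
  have := R.jL_full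
  have := R.jL_faithful
  have := R.jR_full
  have := R.jR_faithful
  constructor
  · rintro ⟨hC, -⟩ hB - I _
    have := hC I
    exact .of_adjointTriple R.jL_adj_j R.j_adj_jR R.jL_rightExact.deflation
      R.j_extriangulated (hB I)
  -- In the opposite triple `jR.op` plays the role of `jL`, and left exactness of `jR` supplies the
  -- preservation of deflations. Products in `C` become the required coproducts in `Cᵒᵖ`.
  · rintro ⟨hC, -⟩ hB - I _
    have := hC I
    have : HasCoproductsOfShape I Cᵒᵖ := inferInstance
    have : IsIso R.j_adj_jR.op.unit := inferInstance
    have : IsIso R.jL_adj_j.op.counit := inferInstance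
    exact .of_adjointTriple R.j_adj_jR.op R.jL_adj_j.op R.jR_leftExact.deflation_op
      R.j_extriangulated.op (hB I)
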